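/- Let $d \geq 2$ be an integer with $d \neq 5$, and let $T_d$ be the $d$-regular tree. Equip $\mathrm{Aut}(T_d)$ with the permutation topology, i.e. the group topology in which the pointwise stabilizers of finite sets of vertices form a neighbourhood basis of the identity; it is a compactly generated, totally disconnected, locally compact group. A Cayley–Abels graph for a totally disconnected, locally compact group $G$ is a connected, locally finite simple graph on which $G$ acts by automorphisms, transitively on vertices and with compact open vertex stabilizers; if $G$ is compactly generated, $\mathrm{md}(G)$ denotes the minimal degree of a Cayley–Abels graph for $G$. Then $\mathrm{md}(\mathrm{Aut}(T_d)) = d$, and $T_d$ (with its natural action of $\mathrm{Aut}(T_d)$) is a Cayley–Abels graph for $\mathrm{Aut}(T_d)$ of minimal degree. -/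

import Mathlib

universe u v w

/-- The permutation topology on the automorphism group of a graph: the topology of pointwise
convergence on the vertex set, the vertex set being discrete. -/
instance permutationTopology {V : Type u} (Γ : SimpleGraph V) : TopologicalSpace (Γ ≃g Γ) :=
  TopologicalSpace.induced (fun (g : Γ ≃g Γ) (x : V) => g x)
    (@Pi.topologicalSpace V (fun _ => V) (fun _ => ⊥))

/-- The pointwise stabilizers of finite vertex sets form a neighbourhood basis of
the identity. -/
theorem permutationTopology_hasBasis {V : Type u} (Γ : SimpleGraph V) :
    (nhds (1 : Γ ≃g Γ)).HasBasis (fun Φ : Set V => Φ.Finite)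
      (fun Φ => {g : Γ ≃g Γ | ∀ x ∈ Φ, g x = x}) := by
  let : TopologicalSpace V := ⊥
  have : DiscreteTopology V := ⟨rfl⟩
  rw [nhds_induced, nhds_pi]
  simp only [nhds_discrete]
  refine ⟨fun t => ?_⟩
  rw [((Filter.hasBasis_pi fun x : V => Filter.hasBasis_pure _).comap _).mem_iff]
  constructor
  · rintro ⟨⟨I, f⟩, ⟨hI, -⟩, h⟩
    exact ⟨I, hI, fun g hg => h fun x hx => hg x hx⟩
  · rintro ⟨I, hI, h⟩
    exact ⟨⟨I, fun _ => ()⟩, ⟨hI, fun _ _ => trivial⟩, fun g hg => h fun x hx => hg x hx⟩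

/-- A totally disconnected, locally compact (Hausdorff) topological group. -/
structure IsTDLCGroup (G : Type u) [Group G] [TopologicalSpace G] : Prop where
  isTopologicalGroup : IsTopologicalGroup G
  t2Space : T2Space G
  locallyCompactSpace : LocallyCompactSpace G
  totallyDisconnectedSpace : TotallyDisconnectedSpace G

/-- A topological group generated by some compact subset. -/
def IsCompactlyGeneratedGroup (G : Type u) [Group G] [TopologicalSpace G] : Prop :=
  ∃ K : Set G, IsCompact K ∧ Subgroup.closure K = ⊤

/-- The graph `Γ` is locally finite and regular of degree `n`. -/
def IsRegularGraph {V : Type u} (Γ : SimpleGraph V) (n : ℕ) : Prop :=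
  ∃ _ : Γ.LocallyFinite, Γ.IsRegularOfDegree n

/-- The graph `Γ`, with the action `ρ` of the group `G` by graph automorphisms, is a
Cayley–Abels graph for `G`: it is connected and locally finite, and `G` acts vertex-transitively
with compact open vertex stabilizers. -/
structure IsCayleyAbelsGraph {G : Type u} [Group G] [TopologicalSpace G] {V : Type v}
    {Γ : SimpleGraph V} (ρ : G →* (Γ ≃g Γ)) : Prop where
  connected : Γ.Connected
  locallyFinite : Nonempty Γ.LocallyFinite
  transitive : ∀ α β : V, ∃ g : G, ρ g α = β
  isOpen_stabilizer : ∀ α : V, IsOpen {g : G | ρ g α = α}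
  isCompact_stabilizer : ∀ α : V, IsCompact {g : G | ρ g α = α}

/-- The minimal degree `md(G)`: the least degree of a Cayley–Abels graph for `G` (and `⊤` if there
is none). Vertex sets may be taken in the universe of `G`, since by transitivity the vertex set
of a Cayley–Abels graph is in bijection with `G ⧸ U` for a vertex stabilizer `U`. -/
noncomputable def minimalDegree (G : Type u) [Group G] [TopologicalSpace G] : ℕ∞ :=
  sInf {n : ℕ∞ | ∃ (V : Type u) (Γ : SimpleGraph V) (ρ : G →* (Γ ≃g Γ)) (m : ℕ),
    IsCayleyAbelsGraph ρ ∧ IsRegularGraph Γ m ∧ n = (m : ℕ∞)}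

/-- `Γ`, with the action `ρ` of `G`, is a Cayley–Abels graph for `G` whose degree is at most that
of any other Cayley–Abels graph for `G` (with vertex set in an arbitrary universe `w`). -/
def IsMinimalDegreeCayleyAbelsGraph {G : Type u} [Group G] [TopologicalSpace G] {V : Type v}
    {Γ : SimpleGraph V} (ρ : G →* (Γ ≃g Γ)) : Prop :=
  IsCayleyAbelsGraph ρ ∧ ∃ n : ℕ, IsRegularGraph Γ n ∧
    ∀ (V' : Type w) (Γ' : SimpleGraph V') (ρ' : G →* (Γ' ≃g Γ')) (m : ℕ),
      IsCayleyAbelsGraph ρ' → IsRegularGraph Γ' m → n ≤ m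

/-! The tree is itself a Cayley–Abels graph of degree `d`, so only the lower bound needs an
argument. Write `d = n + 1` and let `Γ` be a Cayley–Abels graph of degree `m < d`. The pointwise
stabilizer of a vertex of `Γ` and its neighbours is open, so it contains the pointwise stabilizer of
a finite set in the tree. The latter contains a copy of `Sym(n)`, permuting branches far from a base
edge (`exists_perm_hom_fixing`). Its nontrivial elements move tree vertices arbitrarily far, whereas
elements acting trivially on `Γ` have bounded displacement
(`IsCayleyAbelsGraph.map_ne_one_of_unbounded`). Hence a simple subgroup `A` of `Sym(n)` acts
nontrivially on `Γ`. At the edge of its fixed set it acts nontrivially, so faithfully, on `m - 1`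
neighbours of a fixed vertex, and `|A| ≤ (m - 1)! ≤ (n - 1)!`
(`card_le_factorial_of_isSimpleGroup`). For `n = 2` the whole of `Sym(2)`, and for `n = 3` or `n ≥
5` the group `Alt(n)`, is simple and too large for this. `Alt(4)` is not simple, whence `d ≠ 5`. For
`d = 2`, a graph of degree at most one is finite and would force the group to be compact. -/

/-! ### The permutation topology: compactness and generation -/

section Topology

variable {V : Type u} {Γ : SimpleGraph V}

theorem isOpen_setOf_apply_eq (x y : V) : IsOpen {g : Γ ≃g Γ | g x = y} := by
  let : TopologicalSpace V := ⊥
  have : DiscreteTopology V := ⟨rfl⟩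
  have h : Continuous fun g : Γ ≃g Γ => g x :=
    (continuous_apply x).comp (continuous_induced_dom (f := fun (g : Γ ≃g Γ) (x : V) => g x))
  exact (isOpen_discrete {y}).preimage h

theorem continuous_of_isOpen_setOf_apply_eq {X : Type*} [TopologicalSpace X] {f : X → (Γ ≃g Γ)}
    (h : ∀ x y, IsOpen {t | f t x = y}) : Continuous f := by
  let : TopologicalSpace V := ⊥
  have : DiscreteTopology V := ⟨rfl⟩
  refine continuous_induced_rng.2 (continuous_pi fun x => ?_)
  refine continuous_discrete_rng.2 fun y => h x y

instance permutationTopology_isTopologicalGroup : IsTopologicalGroup (Γ ≃g Γ) where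
  continuous_mul := by
    refine continuous_of_isOpen_setOf_apply_eq fun x y => ?_
    have : {t : (Γ ≃g Γ) × (Γ ≃g Γ) | (t.1 * t.2) x = y} =
        ⋃ z, {g : Γ ≃g Γ | g z = y} ×ˢ {h : Γ ≃g Γ | h x = z} := by
      ext t
      simp [RelIso.mul_apply]
    rw [this]
    exact isOpen_iUnion fun z => (isOpen_setOf_apply_eq z y).prod (isOpen_setOf_apply_eq x z)
  continuous_inv := by
    refine continuous_of_isOpen_setOf_apply_eq fun x y => ?_
    have : {t : Γ ≃g Γ | t⁻¹ x = y} = {t : Γ ≃g Γ | t y = x} := by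
      ext t
      constructor
      · rintro rfl
        exact t.apply_symm_apply x
      · rintro rfl
        exact t.symm_apply_apply y
    rw [this]
    exact isOpen_setOf_apply_eq y x

theorem permutationTopology_t2Space : T2Space (Γ ≃g Γ) := by
  refine ⟨fun g h hne => ?_⟩
  obtain ⟨x, hx⟩ : ∃ x, g x ≠ h x := by
    by_contra! hcon
    exact hne (RelIso.ext hcon)
  refine ⟨_, _, isOpen_setOf_apply_eq x (g x), isOpen_setOf_apply_eq x (h x), rfl, rfl, ?_⟩
  rw [Set.disjoint_left]
  intro k hk hk'
  exact hx (Eq.trans (Eq.symm hk) hk')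

theorem permutationTopology_totallyDisconnectedSpace : TotallyDisconnectedSpace (Γ ≃g Γ) := by
  let : TopologicalSpace V := ⊥
  have : DiscreteTopology V := ⟨rfl⟩
  have hc : Continuous fun (g : Γ ≃g Γ) (x : V) => g x := continuous_induced_dom
  have hi : Function.Injective fun (g : Γ ≃g Γ) (x : V) => g x :=
    fun g h hgh => RelIso.ext fun x => congrFun hgh x
  refine ⟨fun t _ ht => ?_⟩
  have := (ht.image _ hc.continuousOn).subsingleton
  exact fun a ha b hb => hi (this ⟨a, ha, rfl⟩ ⟨b, hb, rfl⟩)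

theorem finite_image_apply_of_isCompact {K : Set (Γ ≃g Γ)} (hK : IsCompact K) (x : V) :
    ((fun g : Γ ≃g Γ => g x) '' K).Finite := by
  let : TopologicalSpace V := ⊥
  have : DiscreteTopology V := ⟨rfl⟩
  have h : Continuous fun g : Γ ≃g Γ => g x :=
    (continuous_apply x).comp (continuous_induced_dom (f := fun (g : Γ ≃g Γ) (x : V) => g x))
  exact (hK.image h).finite_of_discrete

/-- Along an ultrafilter on `K` the values at each vertex are eventually constant, which gives a
pointwise limit. Finiteness for inverses makes this limit a bijection. -/
theorem isCompact_of_finite_orbits {K : Set (Γ ≃g Γ)}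
    (hcl : ∀ f : Γ ≃g Γ, f ∈ closure K → f ∈ K)
    (h : ∀ x, ((fun g : Γ ≃g Γ => g x) '' K).Finite)
    (h' : ∀ x, ((fun g : Γ ≃g Γ => g.symm x) '' K).Finite) : IsCompact K := by
  rw [isCompact_iff_ultrafilter_le_nhds]
  intro F hF
  have hFK : K ∈ F := Filter.le_principal_iff.1 hF
  have key : ∀ e : (Γ ≃g Γ) → V, (e '' K).Finite → ∃ y, ∀ᶠ g in (F : Filter (Γ ≃g Γ)), e g = y := by
    intro e he
    have h1 : (⋃ y ∈ e '' K, {g | e g = y}) ∈ F :=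
      Filter.mem_of_superset hFK fun g hg => by
        simp only [Set.mem_iUnion]
        exact ⟨e g, ⟨g, hg, rfl⟩, rfl⟩
    obtain ⟨y, -, hy⟩ := (Ultrafilter.finite_biUnion_mem_iff he).1 h1
    exact ⟨y, hy⟩
  choose f hf using fun x => key (fun g => g x) (h x)
  choose f' hf' using fun x => key (fun g => g.symm x) (h' x)
  let φ : Γ ≃g Γ :=
    { toFun := f
      invFun := f'
      left_inv := fun x => by
        obtain ⟨g, h1, h2⟩ := ((hf x).and (hf' (f x))).exists
        rw [← h2, ← h1, RelIso.symm_apply_apply]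
      right_inv := fun x => by
        obtain ⟨g, h1, h2⟩ := ((hf' x).and (hf (f' x))).exists
        rw [← h2, ← h1, RelIso.apply_symm_apply]
      map_rel_iff' := fun {x y} => by
        obtain ⟨g, h1, h2⟩ := ((hf x).and (hf y)).exists
        change Γ.Adj (f x) (f y) ↔ _
        rw [← h1, ← h2]
        exact g.map_adj_iff }
  have hle : (F : Filter (Γ ≃g Γ)) ≤ nhds φ := by
    let : TopologicalSpace V := ⊥
    have : DiscreteTopology V := ⟨rfl⟩
    rw [nhds_induced, nhds_pi, ← Filter.map_le_iff_le_comap]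
    refine Filter.le_pi.2 fun x => ?_
    rw [nhds_discrete]
    exact Filter.tendsto_pure.2 (hf x)
  refine ⟨φ, hcl φ ?_, hle⟩
  exact mem_closure_iff_ultrafilter.2 ⟨F, hFK, hle⟩

theorem finite_setOf_adj {V : Type*} {Γ : SimpleGraph V} (hΓ : Γ.LocallyFinite) (x : V) :
    {y | Γ.Adj x y}.Finite :=
  have := hΓ x
  Set.toFinite (Γ.neighborSet x)

theorem isCompact_setOf_apply_mem (hconn : Γ.Connected) (hΓ : Γ.LocallyFinite) (o : V)
    {S : Set V} (hS : S.Finite) : IsCompact {g : Γ ≃g Γ | g o ∈ S} := by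
  -- Finiteness of the set of images spreads along edges by local finiteness.
  have step : ∀ (K : Set (Γ ≃g Γ)) (o : V), ((fun g : Γ ≃g Γ => g o) '' K).Finite →
      ∀ x, ((fun g : Γ ≃g Γ => g x) '' K).Finite := by
    intro K o ho x
    obtain ⟨p⟩ := hconn o x
    induction p with
    | nil => exact ho
    | cons hadj _ ih =>
      refine ih ((ho.biUnion fun z _ => finite_setOf_adj hΓ z).subset ?_)
      rintro _ ⟨g, hg, rfl⟩
      simp only [Set.mem_iUnion]
      exact ⟨_, ⟨g, hg, rfl⟩, g.map_adj_iff.2 hadj⟩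
  refine isCompact_of_finite_orbits ?_ (step _ o (hS.subset ?_)) ?_
  · intro f hf
    obtain ⟨g, h1, h2⟩ := mem_closure_iff.1 hf _ (isOpen_setOf_apply_eq o (f o)) rfl
    change f o ∈ S
    rw [← show g o = f o from h1]
    exact h2
  · rintro _ ⟨g, hg, rfl⟩
    exact hg
  · intro x
    -- If `g o = s`, then `g.symm` sends `s` to `o`, so inverses fall into finitely many sets to
    -- which `step` applies.
    have hS' : ∀ s ∈ S, ((fun g : Γ ≃g Γ => g x) '' {g | g s = o}).Finite := fun s _ =>
      step _ s ((Set.finite_singleton o).subset (by rintro _ ⟨g, hg, rfl⟩; exact hg)) x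
    refine (hS.biUnion hS').subset ?_
    rintro _ ⟨g, hg, rfl⟩
    simp only [Set.mem_iUnion]
    exact ⟨g o, hg, g.symm, g.symm_apply_apply o, rfl⟩

theorem isCompact_stabilizer_of_locallyFinite (hconn : Γ.Connected) (hΓ : Γ.LocallyFinite)
    (o : V) : IsCompact {g : Γ ≃g Γ | g o = o} :=
  isCompact_setOf_apply_mem hconn hΓ o (Set.finite_singleton o)

theorem isTDLCGroup_of_locallyFinite (hconn : Γ.Connected) (hΓ : Γ.LocallyFinite) :
    IsTDLCGroup (Γ ≃g Γ) where
  isTopologicalGroup := inferInstance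
  t2Space := permutationTopology_t2Space
  locallyCompactSpace := by
    obtain ⟨o⟩ := hconn.nonempty
    refine (isCompact_stabilizer_of_locallyFinite hconn hΓ o).locallyCompactSpace_of_mem_nhds_of_group
      (x := 1) ?_
    exact (isOpen_setOf_apply_eq o o).mem_nhds rfl
  totallyDisconnectedSpace := permutationTopology_totallyDisconnectedSpace

/-- Elements moving `o` by at most one edge suffice: products of them carry `o` along any walk, and
the stabilizer of `o` is among them. -/
theorem isCompactlyGeneratedGroup_of_transitive (hconn : Γ.Connected) (hΓ : Γ.LocallyFinite)
    (htrans : ∀ x y : V, ∃ g : Γ ≃g Γ, g x = y) : IsCompactlyGeneratedGroup (Γ ≃g Γ) := by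
  obtain ⟨o⟩ := hconn.nonempty
  refine ⟨{g | g o ∈ insert o {y | Γ.Adj o y}},
    isCompact_setOf_apply_mem hconn hΓ o ((finite_setOf_adj hΓ o).insert o), ?_⟩
  set K : Set (Γ ≃g Γ) := {g | g o ∈ insert o {y | Γ.Adj o y}}
  have reach : ∀ x, ∃ h ∈ Subgroup.closure K, h o = x := by
    have aux : ∀ y x, Γ.Walk y x → (∃ h ∈ Subgroup.closure K, h o = y) →
        ∃ h ∈ Subgroup.closure K, h o = x := by
      intro y x p
      induction p with
      | nil => exact id
      | @cons a b _ hadj _ ih =>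
        rintro ⟨h, hh, rfl⟩
        obtain ⟨g, hg⟩ := htrans o (h.symm b)
        refine ih ⟨h * g, mul_mem hh (Subgroup.subset_closure (Or.inr ?_)), ?_⟩
        · change Γ.Adj o (g o)
          rw [hg, ← h.map_adj_iff, h.apply_symm_apply]
          exact hadj
        · rw [RelIso.mul_apply, hg, h.apply_symm_apply]
    intro x
    exact aux o x (hconn o x).some ⟨1, one_mem _, rfl⟩
  rw [eq_top_iff]
  intro g _
  obtain ⟨h, hh, hgo⟩ := reach (g o)
  have : h⁻¹ * g ∈ Subgroup.closure K := Subgroup.subset_closure <| Or.inl <| by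
    change h.symm (g o) = o
    rw [← hgo, h.symm_apply_apply]
  simpa using mul_mem hh this

end Topology

/-! ### A model of the regular tree and its branch permutations -/

/-- Two copies of the rooted `n`-ary tree, with their roots joined by an edge. A vertex is recorded
by the word describing the path to it from the root of its copy, the last letter coming first. -/
def doubleTree (n : ℕ) : SimpleGraph (List (Fin n) × Bool) where
  Adj x y := (x.2 = y.2 ∧ ((∃ a, y.1 = a :: x.1) ∨ ∃ a, x.1 = a :: y.1)) ∨
    (x.2 ≠ y.2 ∧ x.1 = [] ∧ y.1 = [])
  symm := ⟨fun x y h => by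
    rcases h with ⟨h, h'⟩ | ⟨h, h1, h2⟩
    · exact Or.inl ⟨h.symm, h'.symm⟩
    · exact Or.inr ⟨h.symm, h2, h1⟩⟩
  loopless := ⟨fun x h => by
    rcases h with ⟨_, ⟨a, h⟩ | ⟨a, h⟩⟩ | ⟨h, _⟩
    · simpa using congrArg List.length h
    · simpa using congrArg List.length h
    · exact h rfl⟩

/-- Apply `σ` to the letters of depth more than `k`. -/
def permLetters {n : ℕ} (k : ℕ) (σ : Equiv.Perm (Fin n)) : List (Fin n) → List (Fin n)
  | [] => []
  | a :: l => (if k ≤ l.length then σ a else a) :: permLetters k σ l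

namespace permLetters

variable {n : ℕ} (k : ℕ) (σ τ : Equiv.Perm (Fin n)) (l : List (Fin n))

@[simp] theorem length_eq : (permLetters k σ l).length = l.length := by
  induction l with
  | nil => rfl
  | cons a l ih => simp [permLetters, ih]

theorem mul_eq : permLetters k (σ * τ) l = permLetters k σ (permLetters k τ l) := by
  induction l with
  | nil => rfl
  | cons a l ih =>
    simp only [permLetters, ih, length_eq]
    split_ifs <;> rfl

theorem one_eq : permLetters k (1 : Equiv.Perm (Fin n)) l = l := by
  induction l with
  | nil => rfl
  | cons a l ih => simp [permLetters, ih]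

theorem eq_self_of_length_le (h : l.length ≤ k) : permLetters k σ l = l := by
  induction l with
  | nil => rfl
  | cons a l ih =>
    simp only [List.length_cons] at h
    rw [permLetters, ih (by omega), if_neg (by omega)]

theorem isSuffix {l' : List (Fin n)} (h : l' <:+ l) :
    permLetters k σ l' <:+ permLetters k σ l := by
  induction l with
  | nil => rw [List.suffix_nil.1 h]
  | cons a l ih =>
    rcases List.suffix_cons_iff.1 h with rfl | h
    · exact List.suffix_rfl
    · exact (ih h).trans (List.suffix_cons _ _)

end permLetters

/-- The action of the permutations of the alphabet on letters of depth more than `k`, as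
automorphisms of the tree. -/
def doubleTreePerm (n k : ℕ) : Equiv.Perm (Fin n) →* (doubleTree n ≃g doubleTree n) where
  toFun σ :=
    { toFun := fun x => (permLetters k σ x.1, x.2)
      invFun := fun x => (permLetters k σ⁻¹ x.1, x.2)
      left_inv := fun x => by simp [← permLetters.mul_eq, permLetters.one_eq]
      right_inv := fun x => by simp [← permLetters.mul_eq, permLetters.one_eq]
      map_rel_iff' := by
        have key : ∀ (σ : Equiv.Perm (Fin n)) (x y : List (Fin n) × Bool), (doubleTree n).Adj x y →
            (doubleTree n).Adj (permLetters k σ x.1, x.2) (permLetters k σ y.1, y.2) := by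
          rintro σ ⟨x, b⟩ ⟨y, c⟩ (⟨h, ⟨a, h'⟩ | ⟨a, h'⟩⟩ | ⟨h, h1, h2⟩)
          · dsimp only at h h'
            subst h h'
            exact Or.inl ⟨rfl, Or.inl ⟨_, rfl⟩⟩
          · dsimp only at h h'
            subst h h'
            exact Or.inl ⟨rfl, Or.inr ⟨_, rfl⟩⟩
          · dsimp only at h h1 h2
            subst h1 h2
            exact Or.inr ⟨h, rfl, rfl⟩
        intro x y
        refine ⟨fun h => ?_, key σ x y⟩
        simpa [← permLetters.mul_eq, permLetters.one_eq] using key σ⁻¹ _ _ h }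
  map_one' := RelIso.ext fun x => Prod.ext (permLetters.one_eq k x.1) rfl
  map_mul' σ τ := RelIso.ext fun x => Prod.ext (permLetters.mul_eq k σ τ x.1) rfl

theorem doubleTreePerm_apply (n k : ℕ) (σ : Equiv.Perm (Fin n)) (x : List (Fin n) × Bool) :
    doubleTreePerm n k σ x = (permLetters k σ x.1, x.2) := rfl

/-- One step removes at most the head letter, so a short walk cannot alter the letters near the
root. -/
theorem drop_isSuffix_of_walk {n : ℕ} {x y : List (Fin n) × Bool} (p : (doubleTree n).Walk x y) :
    x.1.drop p.length <:+ y.1 := by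
  induction p with
  | nil => simp
  | @cons x z y h p ih =>
    refine List.IsSuffix.trans ?_ ih
    rw [SimpleGraph.Walk.length_cons]
    rcases h with ⟨_, ⟨a, h⟩ | ⟨a, h⟩⟩ | ⟨_, h, _⟩
    · rw [h]
      cases hp : p.length with
      | zero => exact (List.drop_suffix _ _).trans (by simp)
      | succ j =>
        rw [List.drop_succ_cons, show j + 1 + 1 = 2 + j by omega, ← List.drop_drop]
        rw [List.drop_drop, Nat.add_comm, ← List.drop_drop]
        exact List.drop_suffix _ _
    · rw [h, List.drop_succ_cons]
    · simp [h]

/-- The displacement of a nontrivial `doubleTreePerm n k σ` is unbounded. -/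
theorem exists_lt_length_of_doubleTreePerm {n : ℕ} (k : ℕ) {σ : Equiv.Perm (Fin n)} (hσ : σ ≠ 1)
    (C : ℕ) : ∃ x, ∀ p : (doubleTree n).Walk x (doubleTreePerm n k σ x), C < p.length := by
  obtain ⟨i, hi⟩ : ∃ i, σ i ≠ i := by
    by_contra! h
    exact hσ (Equiv.ext h)
  -- A walk of length at most `C` preserves the `k + 1` letters nearest the root, but the deepest of
  -- these is changed from `i` to `σ i`.
  refine ⟨(List.replicate (k + 1 + C) i, false), fun p => ?_⟩
  by_contra! hp
  have h1 := drop_isSuffix_of_walk p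
  have h2 : List.replicate (k + 1) i <:+ permLetters k σ (List.replicate (k + 1 + C) i) := by
    refine List.IsSuffix.trans ?_ h1
    rw [List.drop_replicate, List.suffix_replicate_iff]
    simp
    omega
  have h3 : permLetters k σ (List.replicate (k + 1) i) <:+
      permLetters k σ (List.replicate (k + 1 + C) i) :=
    permLetters.isSuffix k σ _ (by simp [List.suffix_replicate_iff])
  have h4 := (List.suffix_of_suffix_length_le h2 h3 (by simp)).eq_of_length (by simp)
  rw [List.replicate_succ, permLetters, List.cons.injEq, if_pos (by simp)] at h4
  exact hi h4.1.symm

/-! ### Coordinates on a regular tree -/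

section Coordinates

variable {V : Type u} {T : SimpleGraph V}

/-- Geodesics from `r` through `y` and through `z` extend to paths from `r` to `x`, and a tree has
only one. -/
theorem SimpleGraph.IsTree.eq_of_adj_of_dist_lt (hT : T.IsTree) {r x y z : V}
    (hy : T.Adj y x) (hz : T.Adj z x) (hdy : T.dist r x = T.dist r y + 1)
    (hdz : T.dist r x = T.dist r z + 1) : y = z := by
  obtain ⟨p, hp⟩ := hT.connected.exists_walk_length_eq_dist r y
  obtain ⟨q, hq⟩ := hT.connected.exists_walk_length_eq_dist r z
  have h1 : (p.concat hy).IsPath := SimpleGraph.Walk.isPath_of_length_eq_dist _ (by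
    rw [SimpleGraph.Walk.length_concat, hp, hdy])
  have h2 : (q.concat hz).IsPath := SimpleGraph.Walk.isPath_of_length_eq_dist _ (by
    rw [SimpleGraph.Walk.length_concat, hq, hdz])
  have h3 := (hT.existsUnique_path r x).unique h1 h2
  simpa using congrArg SimpleGraph.Walk.penultimate h3

/-- The vertex reached from `x`, entered from `p`, along a word, together with its
predecessor; `c x p` enumerates the continuations at `x` of a path entering from `p`. -/
def descend {n : ℕ} (c : V → V → Fin n → V) (x p : V) : List (Fin n) → V × V
  | [] => (x, p)
  | a :: l => (c (descend c x p l).1 (descend c x p l).2 a, (descend c x p l).1)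

/-- `c x p` enumerates the neighbours of `x` other than `p`. -/
structure IsContinuation (T : SimpleGraph V) {n : ℕ} (c : V → V → Fin n → V) : Prop where
  adj : ∀ {x p}, T.Adj x p → ∀ a, T.Adj x (c x p a)
  ne : ∀ {x p}, T.Adj x p → ∀ a, c x p a ≠ p
  injective : ∀ {x p}, T.Adj x p → Function.Injective (c x p)
  exists_eq : ∀ {x p y}, T.Adj x p → T.Adj x y → y ≠ p → ∃ a, c x p a = y

theorem exists_isContinuation {n : ℕ} (hreg : IsRegularGraph T (n + 1)) :
    ∃ c : V → V → Fin n → V, IsContinuation T c := by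
  classical
  obtain ⟨hlf, hdeg⟩ := hreg
  have key : ∀ x p, T.Adj x p → Nonempty (Fin n ≃ {y // y ∈ (T.neighborFinset x).erase p}) := by
    intro x p hp
    refine ⟨(Finset.equivFinOfCardEq ?_).symm⟩
    rw [Finset.card_erase_of_mem (by simpa using hp), SimpleGraph.card_neighborFinset_eq_degree,
      hdeg x, Nat.add_sub_cancel]
  refine ⟨fun x p a => if h : T.Adj x p then ((key x p h).some a : V) else x, ?_, ?_, ?_, ?_⟩
  · intro x p h a
    have := ((key x p h).some a).2
    rw [Finset.mem_erase, SimpleGraph.mem_neighborFinset] at this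
    simpa only [dif_pos h] using this.2
  · intro x p h a
    have := ((key x p h).some a).2
    rw [Finset.mem_erase, SimpleGraph.mem_neighborFinset] at this
    simpa only [dif_pos h] using this.1
  · intro x p h a b hab
    simp only [dif_pos h] at hab
    exact (key x p h).some.injective (Subtype.ext hab)
  · intro x p y h hy hyp
    refine ⟨(key x p h).some.symm ⟨y, by simp [hy, hyp]⟩, ?_⟩
    simp only [dif_pos h, Equiv.apply_symm_apply]

variable {n : ℕ} {c : V → V → Fin n → V}

theorem IsContinuation.adj_descend (hc : IsContinuation T c) {x p : V} (h : T.Adj x p)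
    (l : List (Fin n)) : T.Adj (descend c x p l).1 (descend c x p l).2 := by
  induction l with
  | nil => exact h
  | cons a l ih => exact (hc.adj ih a).symm

theorem IsContinuation.dist_descend (hc : IsContinuation T c) (hT : T.IsTree) {x p : V}
    (h : T.Adj x p) (l : List (Fin n)) :
    T.dist p (descend c x p l).1 = l.length + 1 ∧ T.dist p (descend c x p l).2 = l.length := by
  induction l with
  | nil => simpa [descend] using h.symm
  | cons a l ih =>
    have hadj := hc.adj_descend h l
    refine ⟨?_, ih.1⟩
    simp only [descend, List.length_cons]
    rcases hT.dist_eq_dist_add_one_of_adj p (hc.adj hadj a) with h1 | h1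
    · exact absurd (hT.eq_of_adj_of_dist_lt (hc.adj hadj a).symm hadj.symm h1
        (by rw [ih.1, ih.2])) (hc.ne hadj a)
    · rw [h1, ih.1]

theorem IsContinuation.dist_descend_le (hc : IsContinuation T c) (hT : T.IsTree) {x p : V}
    (h : T.Adj x p) (l : List (Fin n)) : T.dist x (descend c x p l).1 ≤ l.length := by
  induction l with
  | nil => simp [descend]
  | cons a l ih =>
    rcases hT.dist_eq_dist_add_one_of_adj x (hc.adj (hc.adj_descend h l) a) with h1 | h1 <;>
    · simp only [descend, List.length_cons]
      omega

/-- The distance from `p` recovers the length of the word; uniqueness of the predecessor then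
recovers its letters one at a time. -/
theorem IsContinuation.descend_injective (hc : IsContinuation T c) (hT : T.IsTree) {x p : V}
    (h : T.Adj x p) : Function.Injective fun l => (descend c x p l).1 := by
  intro l
  induction l with
  | nil =>
    intro l' hl
    have h1 := (hc.dist_descend hT h []).1
    rw [show (descend c x p []).1 = (descend c x p l').1 from hl, (hc.dist_descend hT h l').1] at h1
    exact (List.length_eq_zero_iff.1 (by simpa using h1)).symm
  | cons a l ih =>
    intro l' hl
    have h1 := (hc.dist_descend hT h (a :: l)).1
    have hl' : (descend c x p (a :: l)).1 = (descend c x p l').1 := hl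
    rw [hl', (hc.dist_descend hT h l').1] at h1
    cases l' with
    | nil => simp at h1
    | cons b l' =>
      have e : (descend c x p l).1 = (descend c x p l').1 := by
        refine hT.eq_of_adj_of_dist_lt (r := p) (x := (descend c x p (a :: l)).1)
          (hc.adj (hc.adj_descend h l) a) ?_ ?_ ?_
        · rw [hl']
          exact hc.adj (hc.adj_descend h l') b
        · rw [(hc.dist_descend hT h (a :: l)).1, (hc.dist_descend hT h l).1, List.length_cons]
        · rw [hl', (hc.dist_descend hT h (b :: l')).1, (hc.dist_descend hT h l').1,
            List.length_cons]
      obtain rfl := ih e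
      rw [hc.injective (hc.adj_descend h l) hl']

/-- A regular tree is isomorphic to the double tree, with any prescribed vertex going to the root
of a copy. -/
theorem exists_iso_doubleTree (hT : T.IsTree) (hreg : IsRegularGraph T (n + 1)) (o : V) :
    ∃ e : doubleTree n ≃g T, e ([], false) = o := by
  obtain ⟨c, hc⟩ := exists_isContinuation hreg
  obtain ⟨o', ho⟩ : ∃ o', T.Adj o o' := by
    obtain ⟨hlf, hdeg⟩ := hreg
    exact (T.degree_pos_iff_exists_adj o).1 (by rw [hdeg o]; omega)
  let f : List (Fin n) × Bool → V := fun x =>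
    (if x.2 then descend c o' o x.1 else descend c o o' x.1).1
  have hf : ∀ l, f (l, false) = (descend c o o' l).1 := fun _ => rfl
  have ht : ∀ l, f (l, true) = (descend c o' o l).1 := fun _ => rfl
  -- Vertices of the first copy are closer to `o` than to `o'`, those of the second closer to `o'`.
  have hne : ∀ l l', f (l, false) ≠ f (l', true) := by
    intro l l' h
    rw [hf, ht] at h
    have h1 := (hc.dist_descend hT ho l).1
    have h2 := hc.dist_descend_le hT ho l
    have h3 := (hc.dist_descend hT ho.symm l').1
    have h4 := hc.dist_descend_le hT ho.symm l'
    rw [h] at h1 h2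
    omega
  have hinj : Function.Injective f := by
    rintro ⟨l, _ | _⟩ ⟨l', _ | _⟩ h
    · exact congrArg (·, false) (hc.descend_injective hT ho h)
    · exact absurd h (hne _ _)
    · exact absurd h.symm (hne _ _)
    · exact congrArg (·, true) (hc.descend_injective hT ho.symm h)
  have hadj : ∀ x y, (doubleTree n).Adj x y → T.Adj (f x) (f y) := by
    have key : ∀ l a b, T.Adj (f (l, b)) (f (a :: l, b)) := by
      rintro l a (_ | _)
      · exact hc.adj (hc.adj_descend ho l) a
      · exact hc.adj (hc.adj_descend ho.symm l) a
    rintro ⟨x, b⟩ ⟨y, b'⟩ (⟨h, ⟨a, h'⟩ | ⟨a, h'⟩⟩ | ⟨h, h1, h2⟩)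
    · dsimp only at h h'
      subst h h'
      exact key _ _ _
    · dsimp only at h h'
      subst h h'
      exact (key _ _ _).symm
    · dsimp only at h h1 h2
      subst h1 h2
      rcases b with _ | _ <;> rcases b' with _ | _
      · exact absurd rfl h
      · exact ho
      · exact ho.symm
      · exact absurd rfl h
  -- Lifting of edges yields surjectivity along walks and, with injectivity, reflection of
  -- adjacency.
  have hlift : ∀ x z, T.Adj (f x) z → ∃ y, (doubleTree n).Adj x y ∧ f y = z := by
    rintro ⟨l, b⟩ z hz
    have child : ∀ a, (doubleTree n).Adj (l, b) (a :: l, b) := fun a => Or.inl ⟨rfl, Or.inl ⟨a, rfl⟩⟩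
    have parent : (doubleTree n).Adj (l, b) (l.tail, if l = [] then !b else b) := by
      cases l with
      | nil => exact Or.inr ⟨by simp, rfl, rfl⟩
      | cons a l => exact Or.inl ⟨by simp, Or.inr ⟨a, rfl⟩⟩
    rcases b with _ | _
    · by_cases h : z = (descend c o o' l).2
      · refine ⟨_, parent, ?_⟩
        cases l <;> exact h.symm
      · obtain ⟨a, ha⟩ := hc.exists_eq (hc.adj_descend ho l) hz h
        exact ⟨_, child a, ha⟩
    · by_cases h : z = (descend c o' o l).2
      · refine ⟨_, parent, ?_⟩
        cases l <;> exact h.symm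
      · obtain ⟨a, ha⟩ := hc.exists_eq (hc.adj_descend ho.symm l) hz h
        exact ⟨_, child a, ha⟩
  have hsurj : Function.Surjective f := by
    have aux : ∀ y z, T.Walk y z → (∃ x, f x = y) → ∃ x, f x = z := by
      intro y z p
      induction p with
      | nil => exact id
      | cons h _ ih =>
        rintro ⟨x, rfl⟩
        obtain ⟨x', -, hx'⟩ := hlift x _ h
        exact ih ⟨x', hx'⟩
    exact fun z => aux o z (hT.connected o z).some ⟨([], false), rfl⟩
  refine ⟨⟨Equiv.ofBijective f ⟨hinj, hsurj⟩, fun {x y} => ⟨fun h => ?_, hadj x y⟩⟩, rfl⟩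
  obtain ⟨y', hy', hfy⟩ := hlift x _ h
  rwa [← hinj hfy]

theorem exists_automorphism_apply_eq (hT : T.IsTree) (hreg : IsRegularGraph T (n + 1)) (x y : V) :
    ∃ g : T ≃g T, g x = y := by
  obtain ⟨e, he⟩ := exists_iso_doubleTree hT hreg x
  obtain ⟨e', he'⟩ := exists_iso_doubleTree hT hreg y
  refine ⟨e.symm.trans e', ?_⟩
  rw [RelIso.trans_apply, ← he, e.symm_apply_apply, he']

end Coordinates

/-! ### The lower bound through simple groups -/

section LowerBound

variable {V : Type u} {T : SimpleGraph V} {n : ℕ}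

/-- A copy of `Equiv.Perm (Fin n)` in the automorphism group of the `(n + 1)`-regular tree fixing a
given finite set pointwise, each of whose nontrivial elements has unbounded displacement. -/
theorem exists_perm_hom_fixing (hT : T.IsTree) (hreg : IsRegularGraph T (n + 1)) {Φ : Set V}
    (hΦ : Φ.Finite) : ∃ ψ : Equiv.Perm (Fin n) →* (T ≃g T),
      (∀ σ, ∀ x ∈ Φ, ψ σ x = x) ∧
      ∀ σ, σ ≠ 1 → ∀ C, ∃ x, ∀ p : T.Walk x (ψ σ x), C < p.length := by
  obtain ⟨e, -⟩ := exists_iso_doubleTree hT hreg hT.connected.nonempty.some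
  -- Letters up to depth `k` are left alone, so a bound on the word lengths in `Φ` makes `Φ` fixed.
  obtain ⟨k, hk⟩ := (hΦ.image fun x => (e.symm x).1.length).bddAbove
  let ψ : Equiv.Perm (Fin n) →* (T ≃g T) :=
    { toFun := fun σ => (e.symm.trans (doubleTreePerm n k σ)).trans e
      map_one' := RelIso.ext fun x => by simp
      map_mul' := fun σ τ => RelIso.ext fun x => by simp [RelIso.mul_apply] }
  have hψ : ∀ σ x, ψ σ x = e (doubleTreePerm n k σ (e.symm x)) := fun _ _ => rfl
  refine ⟨ψ, fun σ x hx => ?_, fun σ hσ C => ?_⟩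
  · rw [hψ, doubleTreePerm_apply, permLetters.eq_self_of_length_le k σ _ (hk ⟨x, hx, rfl⟩)]
    exact e.apply_symm_apply x
  · obtain ⟨x, hx⟩ := exists_lt_length_of_doubleTreePerm k hσ C
    refine ⟨e x, fun p => ?_⟩
    have h : e.symm (ψ σ (e x)) = doubleTreePerm n k σ x := by
      rw [hψ, e.symm_apply_apply, e.symm_apply_apply]
    simpa using hx ((p.map e.symm.toHom).copy (e.symm_apply_apply x) h)

variable {W : Type w} {Γ : SimpleGraph W} {ρ : (T ≃g T) →* (Γ ≃g Γ)}

/-- If `ρ g = 1`, every conjugate of `g` lies in the compact stabilizer of `α`, which moves `o` a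
bounded distance. Conjugating by an element taking `x` to `o` turns displacement at `x` into
displacement at `o`. -/
theorem IsCayleyAbelsGraph.map_ne_one_of_unbounded (hρ : IsCayleyAbelsGraph ρ) (hT : T.Connected)
    (htrans : ∀ x y : V, ∃ g : T ≃g T, g x = y) {g : T ≃g T}
    (hg : ∀ C, ∃ x, ∀ p : T.Walk x (g x), C < p.length) : ρ g ≠ 1 := by
  intro h1
  obtain ⟨o⟩ := hT.nonempty
  obtain ⟨α⟩ := hρ.connected.nonempty
  have hfin := finite_image_apply_of_isCompact (hρ.isCompact_stabilizer α) o
  obtain ⟨C, hC⟩ := (hfin.image (T.dist o)).bddAbove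
  obtain ⟨x, hx⟩ := hg C
  obtain ⟨h, rfl⟩ := htrans x o
  have hmem : ρ (h * g * h⁻¹) α = α := by simp [h1]
  have hle : T.dist (h x) (h (g x)) ≤ C := by
    refine hC ⟨_, ⟨_, hmem, rfl⟩, ?_⟩
    change T.dist (h x) (h (g (h.symm (h x)))) = _
    rw [h.symm_apply_apply]
  obtain ⟨p, hp⟩ := hT.exists_walk_length_eq_dist (h x) (h (g x))
  have := hx ((p.map h.symm.toHom).copy (h.symm_apply_apply x) (h.symm_apply_apply (g x)))
  rw [SimpleGraph.Walk.length_copy, SimpleGraph.Walk.length_map] at this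
  omega

/-- In a connected graph, let `F` be a set of vertices containing a vertex and all its neighbours,
but not every vertex. Then some vertex of `F` has a neighbour in `F` and one outside `F`. -/
theorem SimpleGraph.Connected.exists_adj_mem_adj_notMem {W : Type*} {Γ : SimpleGraph W}
    (hΓ : Γ.Connected) {F : Set W} {α : W} (hα : α ∈ F) (hα' : ∀ β, Γ.Adj α β → β ∈ F)
    (hF : ∃ x, x ∉ F) :
    ∃ β ∈ F, ∃ γ ∈ F, ∃ δ, δ ∉ F ∧ Γ.Adj β γ ∧ Γ.Adj β δ := by
  by_contra! hcon
  have aux : ∀ y z, Γ.Walk y z → (y ∈ F ∧ ∀ β, Γ.Adj y β → β ∈ F) → z ∈ F := by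
    intro y z p
    induction p with
    | nil => exact And.left
    | @cons a b _ h _ ih =>
      rintro ⟨ha, hb⟩
      refine ih ⟨hb b h, fun β hβ => ?_⟩
      by_contra hβF
      exact hcon b (hb b h) a ha β hβF h.symm hβ
  obtain ⟨x, hx⟩ := hF
  exact hx (aux α x (hΓ α x).some ⟨hα, hα'⟩)

/-- A simple group acting on a connected `m`-regular graph, nontrivially but fixing a vertex and its
neighbours, has order at most `(m - 1)!`. -/
theorem card_le_factorial_of_isSimpleGroup {W : Type*} {Γ : SimpleGraph W} {m : ℕ}
    (hΓ : Γ.Connected) (hreg : IsRegularGraph Γ m) {A : Type*} [Group A] [IsSimpleGroup A]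
    (ψ : A →* (Γ ≃g Γ)) {α : W} (hα : ∀ a, ψ a α = α) (hα' : ∀ a β, Γ.Adj α β → ψ a β = β)
    (hψ : ∃ a, ψ a ≠ 1) : Nat.card A ≤ (m - 1).factorial := by
  classical
  obtain ⟨hlf, hdeg⟩ := hreg
  have hF : ∃ x, x ∉ {x | ∀ a, ψ a x = x} := by
    by_contra! hcon
    obtain ⟨a, ha⟩ := hψ
    exact ha (RelIso.ext fun x => hcon x a)
  obtain ⟨β, hβ, γ, hγ, δ, hδ, hβγ, hβδ⟩ :=
    hΓ.exists_adj_mem_adj_notMem (F := {x | ∀ a, ψ a x = x}) hα (fun β h a => hα' a β h) hF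
  let X := {x // x ∈ (Γ.neighborFinset β).erase γ}
  have hX : ∀ a x, ψ a x ∈ (Γ.neighborFinset β).erase γ ↔ x ∈ (Γ.neighborFinset β).erase γ := by
    intro a x
    rw [Finset.mem_erase, Finset.mem_erase, SimpleGraph.mem_neighborFinset,
      SimpleGraph.mem_neighborFinset]
    nth_rewrite 1 [← hβ a]
    nth_rewrite 1 [← hγ a]
    rw [(ψ a).map_adj_iff, (ψ a).injective.ne_iff]
  let φ : A →* Equiv.Perm X :=
    { toFun := fun a => Equiv.Perm.subtypePerm (ψ a).toEquiv (hX a)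
      map_one' := Equiv.ext fun x => Subtype.ext (by simp)
      map_mul' := fun a b => Equiv.ext fun x => Subtype.ext (by simp [RelIso.mul_apply]) }
  have hφ : ∀ a (x : X), (φ a x : W) = ψ a x := fun _ _ => rfl
  have hinj : Function.Injective φ := by
    rw [← MonoidHom.ker_eq_bot_iff]
    -- By simplicity the action is faithful or trivial, and a trivial one would fix `δ`.
    refine (IsSimpleGroup.eq_bot_or_eq_top_of_normal φ.ker inferInstance).resolve_right fun h => ?_
    refine hδ fun a => ?_
    have ha : φ a = 1 := MonoidHom.mem_ker.1 (h ▸ Subgroup.mem_top a)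
    have hδX : δ ∈ (Γ.neighborFinset β).erase γ := by
      rw [Finset.mem_erase, SimpleGraph.mem_neighborFinset]
      exact ⟨fun h => hδ (h ▸ hγ), hβδ⟩
    rw [← hφ a ⟨δ, hδX⟩, ha, Equiv.Perm.one_apply]
  refine (Nat.card_le_card_of_injective φ hinj).trans_eq ?_
  rw [Nat.card_perm, Nat.card_eq_fintype_card, Fintype.card_coe,
    Finset.card_erase_of_mem (by simpa using hβγ), SimpleGraph.card_neighborFinset_eq_degree,
    hdeg β]

theorem le_degree_of_isSimpleGroup (hT : T.IsTree) (hreg : IsRegularGraph T (n + 1))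
    (hρ : IsCayleyAbelsGraph ρ) {m : ℕ} (hm : IsRegularGraph Γ m)
    (A : Subgroup (Equiv.Perm (Fin n))) [IsSimpleGroup A] (hA : (n - 1).factorial < Nat.card A) :
    n + 1 ≤ m := by
  by_contra! hlt
  obtain ⟨α⟩ := hρ.connected.nonempty
  obtain ⟨hlf⟩ := hρ.locallyFinite
  let U : Set (T ≃g T) := ⋂ β ∈ insert α {β | Γ.Adj α β}, {g | ρ g β = β}
  have hU : U ∈ nhds (1 : T ≃g T) :=
    (((finite_setOf_adj hlf α).insert α).isOpen_biInter
      fun β _ => hρ.isOpen_stabilizer β).mem_nhds (by simp)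
  obtain ⟨Φ, hΦ, hΦU⟩ := (permutationTopology_hasBasis T).mem_iff.1 hU
  obtain ⟨ψ, hψ, hψ'⟩ := exists_perm_hom_fixing hT hreg hΦ
  have hfix : ∀ σ, ∀ β ∈ insert α {β | Γ.Adj α β}, ρ (ψ σ) β = β := fun σ =>
    Set.mem_iInter₂.1 (hΦU (hψ σ))
  have hle := card_le_factorial_of_isSimpleGroup hρ.connected hm ((ρ.comp ψ).comp A.subtype)
    (fun a => hfix a α (Or.inl rfl)) (fun a β h => hfix a β (Or.inr h)) (by
      obtain ⟨a, ha⟩ := exists_ne (1 : A)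
      refine ⟨a, hρ.map_ne_one_of_unbounded hT.connected
        (exists_automorphism_apply_eq hT hreg) (hψ' a ?_)⟩
      simpa using ha)
  have := Nat.factorial_le (show m - 1 ≤ n - 1 by omega)
  omega

theorem exists_isSimpleGroup_factorial_lt_card (hn : 2 ≤ n) (hn4 : n ≠ 4) :
    ∃ A : Subgroup (Equiv.Perm (Fin n)), IsSimpleGroup A ∧ (n - 1).factorial < Nat.card A := by
  rcases (show n = 2 ∨ 3 ≤ n by omega) with rfl | h3
  · have hc : Nat.card (⊤ : Subgroup (Equiv.Perm (Fin 2))) = 2 := by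
      rw [Subgroup.card_top, Nat.card_perm]
      simp
    have : Fact (Nat.Prime 2) := ⟨Nat.prime_two⟩
    exact ⟨⊤, isSimpleGroup_of_prime_card hc, by rw [hc]; decide⟩
  have : Nontrivial (Fin n) := Fin.nontrivial_iff_two_le.2 hn
  -- The order is `n / 2` times `(n - 1)!`, which exceeds `(n - 1)!` once `n ≥ 3`.
  have hcard : 2 * Nat.card (alternatingGroup (Fin n)) = n * (n - 1).factorial := by
    rw [two_mul_nat_card_alternatingGroup, Nat.card_perm, Nat.card_fin,
      Nat.mul_factorial_pred (by omega)]
  refine ⟨alternatingGroup (Fin n), ?_, ?_⟩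
  · rcases (show n = 3 ∨ 5 ≤ n by omega) with rfl | h5
    · have : Fact (Nat.Prime 3) := ⟨Nat.prime_three⟩
      refine isSimpleGroup_of_prime_card (p := 3) ?_
      have h2 : Nat.factorial (3 - 1) = 2 := rfl
      rw [h2] at hcard
      omega
    · exact alternatingGroup.isSimpleGroup (by simpa using h5)
  · have := Nat.factorial_pos (n - 1)
    nlinarith

/-! ### Finite graphs, the case `d = 2`, and the combined lower bound -/

theorem finite_of_isRegularGraph_le_one {W : Type*} {Γ : SimpleGraph W} {m : ℕ}
    (hΓ : Γ.Connected) (hm : IsRegularGraph Γ m) (hm1 : m ≤ 1) : Finite W := by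
  obtain ⟨hlf, hdeg⟩ := hm
  obtain ⟨α⟩ := hΓ.nonempty
  have hsub : ∀ x y z, Γ.Adj x y → Γ.Adj x z → y = z := by
    intro x y z hy hz
    have hcard : (Γ.neighborFinset x).card ≤ 1 := by
      rwa [SimpleGraph.card_neighborFinset_eq_degree, hdeg x]
    exact Finset.card_le_one.1 hcard y (by simpa using hy) z (by simpa using hz)
  have aux : ∀ y z, Γ.Walk y z → (y = α ∨ Γ.Adj α y) → (z = α ∨ Γ.Adj α z) := by
    intro y z p
    induction p with
    | nil => exact id
    | @cons a b _ h _ ih =>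
      rintro (rfl | ha)
      · exact ih (Or.inr h)
      · exact ih (Or.inl (hsub a b α h ha.symm))
  refine Set.finite_univ_iff.1 (((finite_setOf_adj hlf α).insert α).subset fun z _ => ?_)
  exact aux α z (hΓ α z).some (Or.inl rfl)

/-- If `W` were finite, the group would be a finite union of cosets of a compact stabilizer, hence
compact, and its orbits on `V` would be finite. -/
theorem IsCayleyAbelsGraph.infinite (hρ : IsCayleyAbelsGraph ρ) [Infinite V]
    (htrans : ∀ x y : V, ∃ g : T ≃g T, g x = y) : Infinite W := by
  by_contra hW
  rw [not_infinite_iff_finite] at hW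
  obtain ⟨α⟩ := hρ.connected.nonempty
  have hcoset : ∀ β : W, IsCompact {g : T ≃g T | ρ g α = β} := by
    intro β
    obtain ⟨h, rfl⟩ := hρ.transitive α β
    have : {g : T ≃g T | ρ g α = ρ h α} = (fun g => h * g) '' {g | ρ g α = α} := by
      ext g
      constructor
      · intro hg
        refine ⟨h⁻¹ * g, ?_, by simp⟩
        change ρ (h⁻¹ * g) α = α
        rw [map_mul, RelIso.mul_apply, show ρ g α = ρ h α from hg, ← RelIso.mul_apply, ← map_mul]
        simp
      · rintro ⟨g, hg, rfl⟩
        change ρ (h * g) α = ρ h α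
        rw [map_mul, RelIso.mul_apply, show ρ g α = α from hg]
    rw [this]
    exact (hρ.isCompact_stabilizer α).image (continuous_const_mul h)
  obtain ⟨o⟩ : Nonempty V := inferInstance
  have hfin := finite_image_apply_of_isCompact (isCompact_iUnion hcoset) o
  refine Set.infinite_univ (α := V) (hfin.subset fun x _ => ?_)
  obtain ⟨g, hg⟩ := htrans o x
  exact ⟨g, Set.mem_iUnion.2 ⟨ρ g α, rfl⟩, hg⟩

theorem IsCayleyAbelsGraph.le_degree (hρ : IsCayleyAbelsGraph ρ) (hT : T.IsTree) {d m : ℕ}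
    (hd : 2 ≤ d) (hd5 : d ≠ 5) (hreg : IsRegularGraph T d) (hm : IsRegularGraph Γ m) : d ≤ m := by
  obtain ⟨n, rfl⟩ : ∃ n, d = n + 1 := ⟨d - 1, by omega⟩
  by_cases hn : 2 ≤ n
  · obtain ⟨A, hA, hcard⟩ := exists_isSimpleGroup_factorial_lt_card hn (by omega)
    exact le_degree_of_isSimpleGroup hT hreg hρ hm A hcard
  · by_contra! hlt
    have : Finite W := finite_of_isRegularGraph_le_one hρ.connected hm (by omega)
    -- Here `n = 1`; a nonempty alphabet already has infinitely many words.
    have : Nonempty (Fin n) := ⟨⟨0, by omega⟩⟩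
    obtain ⟨e, -⟩ := exists_iso_doubleTree hT hreg hT.connected.nonempty.some
    have : Infinite V := e.toEquiv.infinite_iff.1 inferInstance
    exact not_finite_iff_infinite.2
      (hρ.infinite (exists_automorphism_apply_eq hT hreg)) inferInstance

end LowerBound

/-! ### The tree attains the bound -/

theorem isCayleyAbelsGraph_id {V : Type u} {Γ : SimpleGraph V} (hconn : Γ.Connected)
    (hΓ : Γ.LocallyFinite) (htrans : ∀ x y : V, ∃ g : Γ ≃g Γ, g x = y) :
    IsCayleyAbelsGraph (MonoidHom.id (Γ ≃g Γ)) where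
  connected := hconn
  locallyFinite := ⟨hΓ⟩
  transitive := htrans
  isOpen_stabilizer α := isOpen_setOf_apply_eq α α
  isCompact_stabilizer α := isCompact_stabilizer_of_locallyFinite hconn hΓ α

theorem corollary4 (d : ℕ) (hd : 2 ≤ d) (hd5 : d ≠ 5)
    {V : Type u} (T : SimpleGraph V) (hT : T.IsTree) (hreg : IsRegularGraph T d) :
    IsTDLCGroup (T ≃g T) ∧ IsCompactlyGeneratedGroup (T ≃g T) ∧
      minimalDegree (T ≃g T) = (d : ℕ∞) ∧
      IsMinimalDegreeCayleyAbelsGraph.{u, u, w} (MonoidHom.id (T ≃g T)) := by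
  have htrans : ∀ x y : V, ∃ g : T ≃g T, g x = y := by
    obtain ⟨n, rfl⟩ : ∃ n, d = n + 1 := ⟨d - 1, by omega⟩
    exact exists_automorphism_apply_eq hT hreg
  obtain ⟨hlf, -⟩ := id hreg
  have hid := isCayleyAbelsGraph_id hT.connected hlf htrans
  refine ⟨isTDLCGroup_of_locallyFinite hT.connected hlf,
    isCompactlyGeneratedGroup_of_transitive hT.connected hlf htrans, le_antisymm ?_ ?_,
    hid, d, hreg, fun _ _ _ _ hρ hm => hρ.le_degree hT hd hd5 hreg hm⟩
  · exact sInf_le ⟨V, T, MonoidHom.id _, d, hid, hreg, rfl⟩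
  · refine le_sInf ?_
    rintro _ ⟨W, Γ, ρ, m, hρ, hm, rfl⟩
    exact_mod_cast hρ.le_degree hT hd hd5 hreg hm
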